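/- Quantifier-free linear integer arithmetic (QFLIA) over a set $V$ of integer variables consists of the Boolean combinations of atoms $t\le u$ and $t=u$, where $t,u$ are linear terms $c+a_1v_1+\dots+a_kv_k$ with integer constants $c,a_1,\dots,a_k$ and $v_1,\dots,v_k\in V$; formulas are interpreted over $\mathbb{Z}$. A QFLIA transition system $(V,\mathrm{Init},\mathrm{TR})$ consists of a finite set $V$ of integer variables, a QFLIA formula $\mathrm{Init}$ over $V$, and a QFLIA formula $\mathrm{TR}$ over $V\uplus V'$, where $V'=\{v' : v\in V\}$ is a copy of $V$. A state is an assignment $s\colon V\to\mathbb{Z}$, and a pair of states $(s,t)$ is a transition if $\mathrm{TR}$ holds when the unprimed variables are evaluated in $s$ and the primed variables in $t$. A safety property is a QFLIA formula $P$ over $V$. A QFLIA inductive invariant for $(V,\mathrm{Init},\mathrm{TR})$ and $P$ is a QFLIA formula $\mathrm{Inv}$ over $V$ such that (i) every state satisfying $\mathrm{Init}$ satisfies $\mathrm{Inv}$; (ii) for every transition $(s,t)$, if $s$ satisfies $\mathrm{Inv}$, then so does $t$; (iii) every state satisfying $\mathrm{Inv}$ satisfies $P$. **Theorem.** The problem of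 inferring QFLIA invariants is undecidable: no algorithm decides, given a QFLIA transition system and a QFLIA safety property, whether a QFLIA inductive invariant for them exists. -/

import Mathlib

/-! ### Syntax and semantics of quantifier-free linear integer arithmetic -/

namespace QFLIA

/-- A linear integer term over the variables `V`: the pair `(c, [(a₁, v₁), …, (aₖ, vₖ)])`
stands for `c + a₁ * v₁ + ⋯ + aₖ * vₖ`, with integer constants `c, a₁, …, aₖ`. -/
abbrev LinTerm (V : Type) : Type := ℤ × List (ℤ × V)

/-- The value of a linear term under an assignment of integers to the variables. -/
def LinTerm.eval {V : Type} (t : LinTerm V) (s : V → ℤ) : ℤ :=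
  t.1 + (t.2.map fun p => p.1 * s p.2).sum

/-- The list of variables occurring in a linear term. -/
def LinTerm.vars {V : Type} (t : LinTerm V) : List V := t.2.map Prod.snd

/-- Renaming of the variables of a linear term. -/
def LinTerm.map {V W : Type} (f : V → W) (t : LinTerm V) : LinTerm W :=
  (t.1, t.2.map fun p => (p.1, f p.2))

/-- Formulas of quantifier-free linear integer arithmetic over the variables `V`: Boolean
combinations of the atoms `t ≤ u` and `t = u`, with linear terms `t`, `u`. (The strict atom
`t < u` is `¬ (u ≤ t)`, and `φ → ψ` is `¬ φ ∨ ψ`.) -/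
inductive Formula (V : Type) : Type
  | le (t u : LinTerm V) : Formula V
  | eq (t u : LinTerm V) : Formula V
  | not (φ : Formula V) : Formula V
  | and (φ ψ : Formula V) : Formula V
  | or (φ ψ : Formula V) : Formula V

namespace Formula

/-- Satisfaction of a formula by an assignment of integers to the variables. -/
def Sat {V : Type} : Formula V → (V → ℤ) → Prop
  | le t u, s => t.eval s ≤ u.eval s
  | eq t u, s => t.eval s = u.eval s
  | not φ, s => ¬ φ.Sat s
  | and φ ψ, s => φ.Sat s ∧ ψ.Sat s
  | or φ ψ, s => φ.Sat s ∨ ψ.Sat s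

/-- The list of variables occurring in a formula. -/
def vars {V : Type} : Formula V → List V
  | le t u => t.vars ++ u.vars
  | eq t u => t.vars ++ u.vars
  | not φ => φ.vars
  | and φ ψ => φ.vars ++ ψ.vars
  | or φ ψ => φ.vars ++ ψ.vars

/-- Renaming of the variables of a formula. -/
def map {V W : Type} (f : V → W) : Formula V → Formula W
  | le t u => le (t.map f) (u.map f)
  | eq t u => eq (t.map f) (u.map f)
  | not φ => not (φ.map f)
  | and φ ψ => and (φ.map f) (ψ.map f)
  | or φ ψ => or (φ.map f) (ψ.map f)

end Formula

/-! ### Transition systems, safety properties and inductive invariants -/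

/-- A transition system expressed in QFLIA, with finitely many integer variables `v₀, …, vₙ₋₁`.
In the transition formula `Sum.inl i` is the unprimed variable `vᵢ` (value in the source state)
and `Sum.inr i` is the primed variable `vᵢ'` (value in the target state). -/
structure TransitionSystem : Type where
  numVars : ℕ
  init : Formula (Fin numVars)
  trans : Formula (Fin numVars ⊕ Fin numVars)

namespace TransitionSystem

/-- A state assigns an integer to each variable. -/
abbrev State (T : TransitionSystem) : Type := Fin T.numVars → ℤ

/-- The transitions: the pairs of states that satisfy the transition formula. -/
def Step (T : TransitionSystem) (s t : T.State) : Prop := T.trans.Sat (Sum.elim s t)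

/-- `Inv` is an inductive invariant for the system `T` and the safety property `P`. -/
structure IsInductiveInvariant (T : TransitionSystem) (P Inv : Formula (Fin T.numVars)) :
    Prop where
  initiation : ∀ s : T.State, T.init.Sat s → Inv.Sat s
  consecution : ∀ s t : T.State, Inv.Sat s → T.Step s t → Inv.Sat t
  safety : ∀ s : T.State, Inv.Sat s → P.Sat s

end TransitionSystem

/-- An instance of the problem of inferring QFLIA invariants: a transition system together with
a safety property, both expressed in QFLIA. -/
structure InferenceInstance : Type where
  sys : TransitionSystem
  prop : Formula (Fin sys.numVars)

/-- The system and the safety property have an inductive invariant expressed in QFLIA. -/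
def InferenceInstance.HasInvariant (I : InferenceInstance) : Prop :=
  ∃ Inv : Formula (Fin I.sys.numVars), I.sys.IsInductiveInvariant I.prop Inv

/-! ### Effective coding of instances by natural numbers

Computability of a predicate on instances refers to a Gödel numbering of them, set up here. -/

namespace Formula

/-- Gödel numbering of formulas. -/
def toNat {V : Type} [Encodable V] : Formula V → ℕ
  | le t u => 5 * Nat.pair (Encodable.encode t) (Encodable.encode u)
  | eq t u => 5 * Nat.pair (Encodable.encode t) (Encodable.encode u) + 1
  | not φ => 5 * φ.toNat + 2
  | and φ ψ => 5 * Nat.pair φ.toNat ψ.toNat + 3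
  | or φ ψ => 5 * Nat.pair φ.toNat ψ.toNat + 4

/-- The formula with a given number. -/
def fromNat {V : Type} [Denumerable V] (k : ℕ) : Formula V :=
  if k % 5 = 0 then
    le (Denumerable.ofNat _ (k / 5).unpair.1) (Denumerable.ofNat _ (k / 5).unpair.2)
  else if k % 5 = 1 then
    eq (Denumerable.ofNat _ (k / 5).unpair.1) (Denumerable.ofNat _ (k / 5).unpair.2)
  else if k % 5 = 2 then not (fromNat (k / 5))
  else if k % 5 = 3 then and (fromNat (k / 5).unpair.1) (fromNat (k / 5).unpair.2)
  else or (fromNat (k / 5).unpair.1) (fromNat (k / 5).unpair.2)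
termination_by k
decreasing_by
  all_goals
    have h1 := Nat.unpair_left_le (k / 5)
    have h2 := Nat.unpair_right_le (k / 5)
    omega

theorem fromNat_toNat {V : Type} [Denumerable V] (φ : Formula V) : fromNat φ.toNat = φ := by
  induction φ with
  | le t u =>
    rw [toNat, fromNat, if_pos (by omega)]
    simp only [show ∀ m, 5 * m / 5 = m by omega, Nat.unpair_pair, Denumerable.ofNat_encode]
  | eq t u =>
    rw [toNat, fromNat, if_neg (by omega), if_pos (by omega),
      show ∀ m, (5 * m + 1) / 5 = m by omega]
    simp only [Nat.unpair_pair, Denumerable.ofNat_encode]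
  | not φ ih =>
    rw [toNat, fromNat, if_neg (by omega), if_neg (by omega), if_pos (by omega),
      show ∀ m, (5 * m + 2) / 5 = m by omega, ih]
  | and φ ψ ih₁ ih₂ =>
    rw [toNat, fromNat, if_neg (by omega), if_neg (by omega), if_neg (by omega),
      if_pos (by omega), show ∀ m, (5 * m + 3) / 5 = m by omega]
    simp [ih₁, ih₂]
  | or φ ψ ih₁ ih₂ =>
    rw [toNat, fromNat, if_neg (by omega), if_neg (by omega), if_neg (by omega),
      if_neg (by omega), show ∀ m, (5 * m + 4) / 5 = m by omega]
    simp [ih₁, ih₂]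

theorem toNat_fromNat {V : Type} [Denumerable V] (k : ℕ) :
    (fromNat k : Formula V).toNat = k := by
  induction k using Nat.strong_induction_on with
  | _ k ih =>
    have h1 := Nat.unpair_left_le (k / 5)
    have h2 := Nat.unpair_right_le (k / 5)
    rw [fromNat]
    split_ifs with a b c d
    · simp only [toNat, Denumerable.encode_ofNat, Nat.pair_unpair]; omega
    · simp only [toNat, Denumerable.encode_ofNat, Nat.pair_unpair]; omega
    · rw [toNat, ih _ (by omega)]; omega
    · rw [toNat, ih _ (by omega), ih _ (by omega), Nat.pair_unpair]; omega
    · rw [toNat, ih _ (by omega), ih _ (by omega), Nat.pair_unpair]; omega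

/-- The numbering of the formulas over a countably infinite supply of variables is bijective. -/
instance instDenumerable {V : Type} [Denumerable V] : Denumerable (Formula V) :=
  Denumerable.mk' ⟨toNat, fromNat, fromNat_toNat, toNat_fromNat⟩

theorem encode_eq_toNat {V : Type} [Denumerable V] (φ : Formula V) :
    Encodable.encode φ = φ.toNat := rfl

theorem ofNat_eq_fromNat {V : Type} [Denumerable V] (k : ℕ) :
    Denumerable.ofNat (Formula V) k = fromNat k :=
  Denumerable.ofNat_of_decode rfl

theorem primrec_linTerm_vars {V : Type} [Denumerable V] :
    Primrec (LinTerm.vars : LinTerm V → List V) :=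
  Primrec.list_map Primrec.snd (Primrec.snd.comp Primrec.snd).to₂

theorem primrec_vars {V : Type} [Denumerable V] : Primrec (vars : Formula V → List V) := by
  let f : Unit → ℕ → List V := fun _ k => (fromNat k : Formula V).vars
  let at' : ℕ → List V := fun m => (Denumerable.ofNat (LinTerm V) m).vars
  let g : Unit → List (List V) → Option (List V) := fun _ L =>
    some (if L.length % 5 = 0 ∨ L.length % 5 = 1 then
        at' (L.length / 5).unpair.1 ++ at' (L.length / 5).unpair.2
      else if L.length % 5 = 2 then (L[L.length / 5]?).getD []
      else (L[(L.length / 5).unpair.1]?).getD [] ++ (L[(L.length / 5).unpair.2]?).getD [])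
  have hat : Primrec at' := primrec_linTerm_vars.comp (Primrec.ofNat _)
  have hlen : Primrec fun p : Unit × List (List V) => p.2.length :=
    Primrec.list_length.comp Primrec.snd
  have hmod : Primrec fun p : Unit × List (List V) => p.2.length % 5 :=
    Primrec.nat_mod.comp hlen (Primrec.const 5)
  have hdiv : Primrec fun p : Unit × List (List V) => p.2.length / 5 :=
    Primrec.nat_div.comp hlen (Primrec.const 5)
  have hl : Primrec fun p : Unit × List (List V) => (p.2.length / 5).unpair.1 :=
    Primrec.fst.comp (Primrec.unpair.comp hdiv)
  have hr : Primrec fun p : Unit × List (List V) => (p.2.length / 5).unpair.2 :=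
    Primrec.snd.comp (Primrec.unpair.comp hdiv)
  have hget : ∀ {i : Unit × List (List V) → ℕ}, Primrec i →
      Primrec fun p : Unit × List (List V) => (p.2[i p]?).getD [] := fun hi =>
    Primrec.option_getD.comp (Primrec.list_getElem?.comp Primrec.snd hi) (Primrec.const [])
  have hg : Primrec₂ g := by
    refine Primrec.option_some.comp (Primrec.ite ?_ ?_ (Primrec.ite ?_ ?_ ?_))
    · exact (Primrec.eq.comp hmod (Primrec.const 0)).or (Primrec.eq.comp hmod (Primrec.const 1))
    · exact Primrec.list_append.comp (hat.comp hl) (hat.comp hr)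
    · exact Primrec.eq.comp hmod (Primrec.const 2)
    · exact hget hdiv
    · exact Primrec.list_append.comp (hget hl) (hget hr)
  have hf : Primrec₂ f := by
    refine Primrec.nat_strong_rec f hg ?_
    rintro ⟨⟩ k
    have h1 := Nat.unpair_left_le (k / 5)
    have h2 := Nat.unpair_right_le (k / 5)
    have look : ∀ i, i < k →
        (((List.range k).map (f ()))[i]?).getD [] = (fromNat i : Formula V).vars := by
      intro i hi
      simp [hi, f]
    simp only [g, List.length_map, List.length_range, Option.some.injEq]
    simp only [f]
    rw [fromNat]
    by_cases a : k % 5 = 0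
    · simp [a, at', vars]
    by_cases b : k % 5 = 1
    · simp [b, at', vars]
    by_cases c : k % 5 = 2
    · rw [if_neg (by omega), if_pos c, if_neg a, if_neg b, if_pos c, look _ (by omega), vars]
    rw [if_neg (by omega), if_neg c, if_neg a, if_neg b, if_neg c, look _ (by omega),
      look _ (by omega)]
    split_ifs <;> rw [vars]
  refine (hf.comp (Primrec.const ()) Primrec.encode).of_eq fun φ => ?_
  simp only [f]
  rw [encode_eq_toNat, fromNat_toNat]

theorem vars_map {V W : Type} (f : V → W) (φ : Formula V) :
    (φ.map f).vars = φ.vars.map f := by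
  induction φ <;> simp_all [map, vars, LinTerm.map, LinTerm.vars, Function.comp_def]

theorem linTerm_map_injective {V W : Type} {f : V → W} (hf : Function.Injective f) :
    Function.Injective (LinTerm.map f) := by
  rintro ⟨c, l⟩ ⟨d, m⟩ h
  simp only [LinTerm.map, Prod.mk.injEq] at h
  obtain ⟨rfl, h⟩ := h
  refine Prod.ext rfl (List.map_injective_iff.mpr ?_ h)
  rintro ⟨a, v⟩ ⟨b, w⟩ h
  simp only [Prod.mk.injEq] at h
  exact Prod.ext h.1 (hf h.2)

theorem map_injective {V W : Type} {f : V → W} (hf : Function.Injective f) :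
    Function.Injective (map f) := by
  have ht := linTerm_map_injective hf
  intro φ
  induction φ with
  | le t u => intro ψ h; cases ψ <;> simp_all [map, ht.eq_iff]
  | eq t u => intro ψ h; cases ψ <;> simp_all [map, ht.eq_iff]
  | not φ ih =>
    intro ψ h
    cases ψ <;> simp only [map, not.injEq, reduceCtorEq] at h
    rw [ih h]
  | and φ₁ φ₂ ih₁ ih₂ =>
    intro ψ h
    cases ψ <;> simp only [map, and.injEq, reduceCtorEq] at h
    rw [ih₁ h.1, ih₂ h.2]
  | or φ₁ φ₂ ih₁ ih₂ =>
    intro ψ h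
    cases ψ <;> simp only [map, or.injEq, reduceCtorEq] at h
    rw [ih₁ h.1, ih₂ h.2]

theorem exists_linTerm_map {V W : Type} (f : V → W) (t : LinTerm W)
    (h : ∀ w ∈ t.vars, ∃ v, f v = w) : ∃ u : LinTerm V, u.map f = t := by
  obtain ⟨c, l⟩ := t
  have : ∃ m : List (ℤ × V), (m.map fun p => (p.1, f p.2)) = l := by
    induction l with
    | nil => exact ⟨[], rfl⟩
    | cons p l ih =>
      obtain ⟨m, hm⟩ := ih fun w hw => h w (List.mem_cons_of_mem _ hw)
      obtain ⟨v, hv⟩ := h p.2 (by simp [LinTerm.vars])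
      exact ⟨(p.1, v) :: m, by simp [hm, hv]⟩
  obtain ⟨m, hm⟩ := this
  exact ⟨(c, m), Prod.ext rfl hm⟩

theorem exists_map {V W : Type} (f : V → W) (φ : Formula W)
    (h : ∀ w ∈ φ.vars, ∃ v, f v = w) : ∃ ψ : Formula V, ψ.map f = φ := by
  induction φ with
  | le t u =>
    obtain ⟨a, ha⟩ := exists_linTerm_map f t fun w hw => h w (List.mem_append_left _ hw)
    obtain ⟨b, hb⟩ := exists_linTerm_map f u fun w hw => h w (List.mem_append_right _ hw)
    exact ⟨le a b, by rw [map, ha, hb]⟩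
  | eq t u =>
    obtain ⟨a, ha⟩ := exists_linTerm_map f t fun w hw => h w (List.mem_append_left _ hw)
    obtain ⟨b, hb⟩ := exists_linTerm_map f u fun w hw => h w (List.mem_append_right _ hw)
    exact ⟨eq a b, by rw [map, ha, hb]⟩
  | not φ ih =>
    obtain ⟨a, ha⟩ := ih h
    exact ⟨not a, by rw [map, ha]⟩
  | and φ ψ ih₁ ih₂ =>
    obtain ⟨a, ha⟩ := ih₁ fun w hw => h w (List.mem_append_left _ hw)
    obtain ⟨b, hb⟩ := ih₂ fun w hw => h w (List.mem_append_right _ hw)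
    exact ⟨and a b, by rw [map, ha, hb]⟩
  | or φ ψ ih₁ ih₂ =>
    obtain ⟨a, ha⟩ := ih₁ fun w hw => h w (List.mem_append_left _ hw)
    obtain ⟨b, hb⟩ := ih₂ fun w hw => h w (List.mem_append_right _ hw)
    exact ⟨or a b, by rw [map, ha, hb]⟩

end Formula

/-- Raw data `(n, Init, TR, P)`: a number of variables and three formulas whose variables are
numbered by arbitrary natural numbers. -/
abbrev RawInstance : Type := ℕ × Formula ℕ × Formula (ℕ ⊕ ℕ) × Formula ℕ

/-- Raw data are well formed if only variables with a number below `n` occur. -/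
def RawInstance.WellFormed (r : RawInstance) : Prop :=
  (∀ v ∈ r.2.1.vars, v < r.1) ∧
  (∀ v ∈ r.2.2.1.vars, Sum.elim id id v < r.1) ∧
  (∀ v ∈ r.2.2.2.vars, v < r.1)

instance RawInstance.instDecidableWellFormed : DecidablePred RawInstance.WellFormed := fun r =>
  inferInstanceAs (Decidable ((∀ v ∈ r.2.1.vars, v < r.1) ∧
    (∀ v ∈ r.2.2.1.vars, Sum.elim id id v < r.1) ∧ (∀ v ∈ r.2.2.2.vars, v < r.1)))

namespace InferenceInstance

/-- An instance, with its variables replaced by their numbers. -/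
def toRaw (I : InferenceInstance) : RawInstance :=
  (I.sys.numVars, I.sys.init.map Fin.val, I.sys.trans.map (Sum.map Fin.val Fin.val),
    I.prop.map Fin.val)

theorem toRaw_wellFormed (I : InferenceInstance) : I.toRaw.WellFormed := by
  refine ⟨?_, ?_, ?_⟩ <;> simp [toRaw, Formula.vars_map]

theorem toRaw_injective : Function.Injective toRaw := by
  rintro ⟨⟨n, i, t⟩, p⟩ ⟨⟨m, j, u⟩, q⟩ h
  simp only [toRaw, Prod.mk.injEq] at h
  obtain ⟨rfl, h1, h2, h3⟩ := h
  obtain rfl := Formula.map_injective Fin.val_injective h1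
  obtain rfl := Formula.map_injective
    (Sum.map_injective.mpr ⟨Fin.val_injective, Fin.val_injective⟩) h2
  obtain rfl := Formula.map_injective Fin.val_injective h3
  rfl

theorem exists_toRaw (r : RawInstance) (h : r.WellFormed) :
    ∃ I : InferenceInstance, I.toRaw = r := by
  obtain ⟨n, i, t, p⟩ := r
  obtain ⟨h1, h2, h3⟩ := h
  obtain ⟨i', hi⟩ := Formula.exists_map (Fin.val : Fin n → ℕ) i
    fun v hv => ⟨⟨v, h1 v hv⟩, rfl⟩
  obtain ⟨p', hp⟩ := Formula.exists_map (Fin.val : Fin n → ℕ) p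
    fun v hv => ⟨⟨v, h3 v hv⟩, rfl⟩
  obtain ⟨t', ht⟩ := Formula.exists_map
    (Sum.map (Fin.val : Fin n → ℕ) (Fin.val : Fin n → ℕ)) t fun v hv => by
      rcases v with v | v
      · exact ⟨Sum.inl ⟨v, h2 _ hv⟩, rfl⟩
      · exact ⟨Sum.inr ⟨v, h2 _ hv⟩, rfl⟩
  exact ⟨⟨⟨n, i', t'⟩, p'⟩, by simp only [toRaw, hi, ht, hp]⟩

/-- Instances correspond bijectively to well-formed raw data. -/
noncomputable def equivRaw : InferenceInstance ≃ {r : RawInstance // r.WellFormed} :=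
  Equiv.ofBijective (fun I => ⟨I.toRaw, I.toRaw_wellFormed⟩)
    ⟨fun _ _ h => toRaw_injective (congrArg Subtype.val h),
      fun r => (exists_toRaw r.1 r.2).imp fun _ h => Subtype.ext h⟩

theorem primrecPred_wellFormed : PrimrecPred RawInstance.WellFormed := by
  have hlt : PrimrecRel fun (v n : ℕ) => v < n := Primrec.nat_lt
  have hlt' : PrimrecRel fun (v : ℕ ⊕ ℕ) (n : ℕ) => Sum.elim id id v < n :=
    hlt.comp (Primrec.sumCasesOn Primrec.fst Primrec.snd.to₂ Primrec.snd.to₂ |>.of_eq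
      fun p => by rcases p with ⟨v | v, n⟩ <;> rfl) Primrec.snd
  have h1 : Primrec fun r : RawInstance => r.2.1.vars :=
    Formula.primrec_vars.comp (Primrec.fst.comp Primrec.snd)
  have h2 : Primrec fun r : RawInstance => r.2.2.1.vars :=
    Formula.primrec_vars.comp (Primrec.fst.comp (Primrec.snd.comp Primrec.snd))
  have h3 : Primrec fun r : RawInstance => r.2.2.2.vars :=
    Formula.primrec_vars.comp (Primrec.snd.comp (Primrec.snd.comp Primrec.snd))
  exact (hlt.forall_mem_list.comp h1 Primrec.fst).and
    ((hlt'.forall_mem_list.comp h2 Primrec.fst).and (hlt.forall_mem_list.comp h3 Primrec.fst))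

/-- The code of an instance is the code of its raw data. -/
noncomputable instance instPrimcodable : Primcodable InferenceInstance :=
  letI : Primcodable {r : RawInstance // r.WellFormed} :=
    Primcodable.subtype primrecPred_wellFormed
  Primcodable.ofEquiv _ equivRaw

theorem encode_eq (I : InferenceInstance) : Encodable.encode I = Encodable.encode I.toRaw := rfl

end InferenceInstance

end QFLIA

/-! The halting problem reduces to the inference of invariants. A program `P` with input `n` becomes
a transition system that runs `P` and carries two more variables, the step count `x` and `y = x ^
2`; the square is updated linearly, as `(x + 1) ^ 2 = x ^ 2 + 2 * x + 1`. A checking phase, which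
may be entered at any time, runs `x` down to zero and updates `y` accordingly; it is an error if `y`
is then nonzero. No reachable state is an error, so the only question is whether a formula can
express a reason for safety.

If `P` halts, a finite set of states is inductive and safe, and finite sets are definable
(`exists_isSafeInductive_of_halts`). If `P` runs forever, every invariant contains the checking
states `(m, m ^ 2)` for all `m`, while inductiveness and safety exclude all other `(m, y)` with `m ≥
0` (`IsSafeInductive.eq_sq`). A Boolean combination of linear atoms cannot do this: for large `n` it
does not separate `(n, n ^ 2)` from `(n, n ^ 2 + 1)` (`Formula.eventually_sat_sq_iff`).

One universal program suffices (`exists_halts_iff_eval_dom`), so the instances differ only in one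
constant of the initial condition, and the reduction is clearly computable. -/

namespace RegisterMachine

/-! ### Register machines -/

/-- Instructions of a register machine with integer registers and relative jumps: `zero r` clears
`r`, `copy r q c` sets `r` to the value of `q` plus `c`, `jeq q r d` jumps forward by `d` if `q` and
`r` agree, and `back d` jumps backward by `d`. -/
inductive Instr : Type
  | zero (r : ℕ)
  | copy (r q : ℕ) (c : ℤ)
  | jeq (q r d : ℕ)
  | back (d : ℕ)

/-- The effect of an instruction on a configuration, a program counter with register contents. -/
def Instr.exec : Instr → ℕ × (ℕ → ℤ) → ℕ × (ℕ → ℤ)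
  | zero r, (p, s) => (p + 1, Function.update s r 0)
  | copy r q c, (p, s) => (p + 1, Function.update s r (s q + c))
  | jeq q r d, (p, s) => (if s q = s r then p + d else p + 1, s)
  | back d, (p, s) => (p - d, s)

/-- One step of a program; a configuration whose program counter is out of range is kept. -/
def step (P : List Instr) (c : ℕ × (ℕ → ℤ)) : ℕ × (ℕ → ℤ) :=
  match P[c.1]? with
  | some i => i.exec c
  | none => c

theorem step_of_getElem? {P : List Instr} {c : ℕ × (ℕ → ℤ)} {i : Instr} (h : P[c.1]? = some i) :
    step P c = i.exec c := by
  simp [step, h]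

theorem step_of_length_le {P : List Instr} {c : ℕ × (ℕ → ℤ)} (h : P.length ≤ c.1) :
    step P c = c := by
  simp [step, h]

/-- The program halts when started with register contents `s`. -/
def Halts (P : List Instr) (s : ℕ → ℤ) : Prop :=
  ∃ m, P.length ≤ ((step P)^[m] (0, s)).1

theorem length_le_iterate_of_le {P : List Instr} {s : ℕ → ℤ} {m k : ℕ} (hmk : m ≤ k)
    (h : P.length ≤ ((step P)^[m] (0, s)).1) : P.length ≤ ((step P)^[k] (0, s)).1 := by
  induction k, hmk using Nat.le_induction with
  | base => exact h
  | succ k _ ih => rwa [Function.iterate_succ_apply', step_of_length_le ih]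

/-! ### Sequential composition and loops -/

/-- In every context, the code fragment `C` runs from its first instruction with register contents
`s` to the instruction after its last one, with register contents `t`. -/
def Runs (C : List Instr) (s t : ℕ → ℤ) : Prop :=
  ∀ A B : List Instr, ∃ m,
    (step (A ++ C ++ B))^[m] (A.length, s) = (A.length + C.length, t)

theorem runs_nil (s : ℕ → ℤ) : Runs [] s s := fun _ _ => ⟨0, rfl⟩

/-- Jumps are relative and `Runs` allows any context, so `D` can serve as context for `C` and `C`
for `D`. -/
theorem Runs.append {C D : List Instr} {s t u : ℕ → ℤ} (h₁ : Runs C s t) (h₂ : Runs D t u) :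
    Runs (C ++ D) s u := by
  intro A B
  obtain ⟨m, hm⟩ := h₁ A (D ++ B)
  obtain ⟨k, hk⟩ := h₂ (A ++ C) B
  refine ⟨k + m, ?_⟩
  simp only [List.append_assoc, List.length_append] at hm hk ⊢
  rw [Function.iterate_add_apply, hm, hk, Nat.add_assoc]

theorem runs_zero (r : ℕ) (s : ℕ → ℤ) : Runs [.zero r] s (Function.update s r 0) :=
  fun A B => ⟨1, by simp [step, Instr.exec]⟩

theorem runs_copy (r q : ℕ) (c : ℤ) (s : ℕ → ℤ) :
    Runs [.copy r q c] s (Function.update s r (s q + c)) :=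
  fun A B => ⟨1, by simp [step, Instr.exec]⟩

/-- Repeat `C` until the registers `q` and `r` agree. -/
def loop (q r : ℕ) (C : List Instr) : List Instr :=
  -- The forward jump skips the body and the closing `back`, which lies `C.length + 1` places after
  -- the test.
  .jeq q r (C.length + 2) :: (C ++ [.back (C.length + 1)])

theorem length_loop (q r : ℕ) (C : List Instr) : (loop q r C).length = C.length + 2 := by
  simp [loop]

theorem runs_loop_of_eq {q r : ℕ} (C : List Instr) {s : ℕ → ℤ} (h : s q = s r) :
    Runs (loop q r C) s s :=
  fun A B => ⟨1, by simp [loop, step, Instr.exec, h]⟩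

/-- One round of the loop: test, body, jump back. That it takes positive time is what lets
`not_halts_append_loop` find the loop head at arbitrarily late times. -/
theorem exists_iterate_loop {q r : ℕ} {C : List Instr} {s t : ℕ → ℤ} (h : s q ≠ s r)
    (hC : Runs C s t) (A B : List Instr) :
    ∃ m, 0 < m ∧ (step (A ++ loop q r C ++ B))^[m] (A.length, s) = (A.length, t) := by
  obtain ⟨m, hm⟩ := hC (A ++ [.jeq q r (C.length + 2)]) (.back (C.length + 1) :: B)
  have hP : A ++ [.jeq q r (C.length + 2)] ++ C ++ .back (C.length + 1) :: B =
      A ++ loop q r C ++ B := by simp [loop]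
  rw [hP] at hm
  refine ⟨1 + m + 1, by omega, ?_⟩
  have h1 : step (A ++ loop q r C ++ B) (A.length, s) = (A.length + 1, s) := by
    simp [loop, step, Instr.exec, h]
  have h2 : step (A ++ loop q r C ++ B) (A.length + 1 + C.length, t) = (A.length, t) := by
    rw [step_of_getElem? (i := .back (C.length + 1))]
    · simp [Instr.exec]; omega
    · rw [← hP, List.getElem?_append_right (by simp; omega)]
      simp [show A.length + 1 + C.length - (A.length + (C.length + 1)) = 0 by omega]
  rw [Function.iterate_add_apply, Function.iterate_add_apply, Function.iterate_one, h1]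
  simp only [List.length_append, List.length_singleton] at hm
  rw [hm, h2]

theorem Runs.loop {q r : ℕ} {C : List Instr} {s t u : ℕ → ℤ} (h : s q ≠ s r) (hC : Runs C s t)
    (hL : Runs (loop q r C) t u) : Runs (loop q r C) s u := by
  intro A B
  obtain ⟨m, -, hm⟩ := exists_iterate_loop h hC A B
  obtain ⟨k, hk⟩ := hL A B
  exact ⟨k + m, by rw [Function.iterate_add_apply, hm, hk]⟩

theorem Runs.halts {P : List Instr} {s t : ℕ → ℤ} (h : Runs P s t) : Halts P s := by
  obtain ⟨m, hm⟩ := h [] []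
  simp only [List.nil_append, List.append_nil, List.length_nil, Nat.zero_add] at hm
  exact ⟨m, by rw [hm]⟩

/-- The loop invariant `I` forces the loop head to be visited arbitrarily late, whereas a halted
configuration stays halted. -/
theorem not_halts_append_loop {q r : ℕ} {A C : List Instr} {s t : ℕ → ℤ} (hA : Runs A s t)
    (I : (ℕ → ℤ) → Prop) (ht : I t) (hI : ∀ u, I u → u q ≠ u r ∧ ∃ w, I w ∧ Runs C u w) :
    ¬ Halts (A ++ loop q r C) s := by
  rintro ⟨m, hm⟩
  have key : ∀ k, ∃ j, k ≤ j ∧ ∃ u, I u ∧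
      (step (A ++ loop q r C))^[j] (0, s) = (A.length, u) := by
    intro k
    induction k with
    | zero =>
      obtain ⟨j, hj⟩ := hA [] (loop q r C)
      exact ⟨j, Nat.zero_le _, t, ht, by simpa using hj⟩
    | succ k ih =>
      obtain ⟨j, hkj, u, hu, hj⟩ := ih
      obtain ⟨hne, w, hw, hC⟩ := hI u hu
      obtain ⟨i, hi, hi'⟩ := exists_iterate_loop hne hC A []
      rw [List.append_nil] at hi'
      exact ⟨i + j, by omega, w, hw, by rw [Function.iterate_add_apply, hj, hi']⟩
  obtain ⟨j, hj, u, -, hu⟩ := key m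
  have := length_le_iterate_of_le hj hm
  rw [hu, List.length_append, length_loop] at this
  simp at this

/-! ### Compilation of primitive recursive functions -/

/-- A function on vectors is computable with scratch space above any bound: given registers
`inp i < b` for the arguments, a code fragment puts the value into register `b` and keeps the
registers below `b`. -/
def Computes {n : ℕ} (f : List.Vector ℕ n → ℕ) : Prop :=
  ∀ (b : ℕ) (inp : Fin n → ℕ), (∀ i, inp i < b) → ∃ C : List Instr,
    ∀ (s : ℕ → ℤ) (v : List.Vector ℕ n), (∀ i, s (inp i) = v.get i) →
      ∃ t, Runs C s t ∧ t b = f v ∧ ∀ r < b, t r = s r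

/-- The `i`-th component is computed with bound `b + i`, so it keeps the arguments and the
components already found. -/
theorem computes_tuple {m n : ℕ} {g : Fin m → List.Vector ℕ n → ℕ} (hg : ∀ i, Computes (g i))
    (b : ℕ) (inp : Fin n → ℕ) (hinp : ∀ i, inp i < b) :
    ∃ C : List Instr, ∀ (s : ℕ → ℤ) (v : List.Vector ℕ n), (∀ i, s (inp i) = v.get i) →
      ∃ t, Runs C s t ∧ (∀ i : Fin m, t (b + i) = g i v) ∧ ∀ r < b, t r = s r := by
  induction m with
  | zero => exact ⟨[], fun s v _ => ⟨s, runs_nil s, fun i => i.elim0, fun _ _ => rfl⟩⟩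
  | succ m ih =>
    obtain ⟨C, hC⟩ := ih fun i => hg i.castSucc
    obtain ⟨D, hD⟩ := hg (Fin.last m) (b + m) inp fun i => by have := hinp i; omega
    refine ⟨C ++ D, fun s v hv => ?_⟩
    obtain ⟨t, ht, hval, hkeep⟩ := hC s v hv
    obtain ⟨u, hu, hval', hkeep'⟩ := hD t v fun i => by rw [hkeep _ (hinp i), hv]
    refine ⟨u, ht.append hu, fun i => ?_, fun r hr => ?_⟩
    · refine Fin.lastCases ?_ (fun j => ?_) i
      · simpa using hval'
      · rw [← hval j]
        exact hkeep' _ (by simp)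
    · rw [hkeep' r (by omega), hkeep r hr]

theorem Computes.comp {m n : ℕ} {f : List.Vector ℕ m → ℕ} {g : Fin m → List.Vector ℕ n → ℕ}
    (hf : Computes f) (hg : ∀ i, Computes (g i)) :
    Computes fun v => f (List.Vector.ofFn fun i => g i v) := by
  intro b inp hinp
  obtain ⟨C, hC⟩ := computes_tuple hg b inp hinp
  obtain ⟨D, hD⟩ := hf (b + m) (fun i => b + i) fun i => by simp
  refine ⟨C ++ D ++ [.copy b (b + m) 0], fun s v hv => ?_⟩
  obtain ⟨t, ht, hval, hkeep⟩ := hC s v hv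
  obtain ⟨u, hu, hval', hkeep'⟩ := hD t (List.Vector.ofFn fun i => g i v) fun i => by
    rw [hval, List.Vector.get_ofFn]
  refine ⟨_, (ht.append hu).append (runs_copy _ _ _ _), by simp [hval'], fun r hr => ?_⟩
  rw [Function.update_of_ne hr.ne, hkeep' r (by omega), hkeep r hr]

/-- Register `b` accumulates the value and `b + 1` counts up to the recursion argument in `inp 0`;
`g` works from `b + 2` on. -/
theorem Computes.prec {n : ℕ} {f : List.Vector ℕ n → ℕ} {g : List.Vector ℕ (n + 2) → ℕ}
    (hf : Computes f) (hg : Computes g) :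
    Computes fun v : List.Vector ℕ (n + 1) =>
      v.head.rec (f v.tail) fun y IH => g (y ::ᵥ IH ::ᵥ v.tail) := by
  intro b inp hinp
  obtain ⟨C, hC⟩ := hf b (fun i => inp i.succ) fun i => hinp _
  obtain ⟨D, hD⟩ := hg (b + 2) (Fin.cons (b + 1) (Fin.cons b fun i => inp i.succ)) (by
    refine Fin.cases (by simp) (Fin.cases (by simp) fun i => ?_)
    have := hinp i.succ
    simp only [Fin.cons_succ]
    omega)
  refine ⟨C ++ [.zero (b + 1)] ++
    loop (b + 1) (inp 0) (D ++ [.copy b (b + 2) 0] ++ [.copy (b + 1) (b + 1) 1]),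
    fun s v hv => ?_⟩
  obtain ⟨t, ht, hval, hkeep⟩ := hC s v.tail fun i => by rw [hv, List.Vector.get_tail_succ]
  set F : ℕ → ℕ := fun k => k.rec (f v.tail) fun y IH => g (y ::ᵥ IH ::ᵥ v.tail)
  have h0 : ∀ u : ℕ → ℤ, (∀ r < b, u r = s r) → u (inp 0) = v.head := fun u hu => by
    rw [hu _ (hinp 0), hv, List.Vector.get_zero]
  -- Induction on the number `j` of rounds left.
  have key : ∀ j k : ℕ, k + j = v.head → ∀ u : ℕ → ℤ, u b = F k → u (b + 1) = k →
      (∀ r < b, u r = s r) → ∃ w, Runs (loop (b + 1) (inp 0)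
        (D ++ [.copy b (b + 2) 0] ++ [.copy (b + 1) (b + 1) 1])) u w ∧
        w b = F v.head ∧ ∀ r < b, w r = s r := by
    intro j
    induction j with
    | zero =>
      intro k hk u hub hub1 hus
      have hk' : k = v.head := hk
      refine ⟨u, runs_loop_of_eq _ ?_, by rw [hub, hk'], hus⟩
      rw [hub1, h0 u hus, hk']
    | succ j ih =>
      intro k hk u hub hub1 hus
      obtain ⟨w, hw, hwval, hwkeep⟩ := hD u (k ::ᵥ F k ::ᵥ v.tail) (by
        refine Fin.cases (by simpa using hub1) (Fin.cases hub fun i => ?_)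
        simp only [Fin.cons_succ, List.Vector.get_cons_succ]
        rw [hus _ (hinp _), hv, List.Vector.get_tail_succ])
      have hrun := (hw.append (runs_copy b (b + 2) 0 w)).append
        (runs_copy (b + 1) (b + 1) 1 _)
      obtain ⟨x, hx, hxb, hxs⟩ := ih (k + 1) (by omega)
        (Function.update (Function.update w b (w (b + 2) + 0)) (b + 1)
          (Function.update w b (w (b + 2) + 0) (b + 1) + 1))
        (by
          rw [Function.update_of_ne (by omega), Function.update_self, hwval, add_zero])
        (by
          rw [Function.update_self, Function.update_of_ne (by omega), hwkeep _ (by omega), hub1]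
          push_cast; rfl)
        (fun r hr => by
          rw [Function.update_of_ne (by omega), Function.update_of_ne (by omega),
            hwkeep r (by omega), hus r hr])
      refine ⟨x, Runs.loop ?_ hrun hx, hxb, hxs⟩
      rw [hub1, h0 u hus]
      exact_mod_cast (by omega : k ≠ v.head)
  obtain ⟨w, hw, hwb, hws⟩ := key v.head 0 (by simp) (Function.update t (b + 1) 0)
    (by rw [Function.update_of_ne (by omega)]; exact hval) (by simp)
    (fun r hr => by rw [Function.update_of_ne (by omega), hkeep r hr])
  exact ⟨w, (ht.append (runs_zero _ _)).append hw, hwb, hws⟩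

theorem computes_of_primrec' {n : ℕ} {f : List.Vector ℕ n → ℕ} (hf : Nat.Primrec' f) :
    Computes f := by
  induction hf with
  | zero =>
    exact fun b inp _ => ⟨[.zero b], fun s v _ => ⟨_, runs_zero b s, by simp, fun r hr => by
      rw [Function.update_of_ne hr.ne]⟩⟩
  | succ =>
    exact fun b inp _ => ⟨[.copy b (inp 0) 1], fun s v hv => ⟨_, runs_copy _ _ _ s, by
      simp [hv, List.Vector.get_zero], fun r hr => by rw [Function.update_of_ne hr.ne]⟩⟩
  | get i =>
    exact fun b inp _ => ⟨[.copy b (inp i) 0], fun s v hv => ⟨_, runs_copy _ _ _ s, by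
      simp [hv], fun r hr => by rw [Function.update_of_ne hr.ne]⟩⟩
  | comp g _ _ ihf ihg => exact ihf.comp ihg
  | prec _ _ ihf ihg => exact ihf.prec ihg

/-! ### Halting sets -/

/-- The initial register contents for the input `n`. -/
def input (n : ℕ) : ℕ → ℤ := Function.update 0 0 n

/-- An existentially quantified primitive recursive predicate is the halting set of a program. -/
theorem exists_halts_iff {g : ℕ → ℕ → ℕ} (hg : Primrec₂ g) :
    ∃ P : List Instr, ∀ n, Halts P (input n) ↔ ∃ k, g n k = 0 := by
  -- Register 0 holds `n`, 1 the candidate `k`, 2 the last value of `g`, 3 the constant zero;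
  -- scratch space begins at 4.
  obtain ⟨C, hC⟩ := computes_of_primrec' (Nat.Primrec'.prim_iff₂.2 hg) 4 ![0, 1]
    (by intro i; fin_cases i <;> simp)
  have hbody : ∀ (n k : ℕ) (u : ℕ → ℤ), u 0 = n → u 1 = k → u 3 = 0 →
      ∃ w, Runs (C ++ [.copy 2 4 0] ++ [.copy 1 1 1]) u w ∧
        w 0 = n ∧ w 1 = (k + 1 : ℕ) ∧ w 2 = g n k ∧ w 3 = 0 := by
    intro n k u h0 h1 h3
    obtain ⟨t, ht, hval, hkeep⟩ := hC u (n ::ᵥ k ::ᵥ .nil) (by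
      intro i; fin_cases i
      · simpa using h0
      · exact h1)
    refine ⟨_, (ht.append (runs_copy 2 4 0 t)).append (runs_copy 1 1 1 _), ?_⟩
    simp [hval, hkeep, h0, h1, h3]
  -- Register 2 starts at 1, so that the test against register 3 does not end the search before the
  -- first evaluation.
  have hstart := fun n => runs_copy 2 2 1 (input n)
  refine ⟨[.copy 2 2 1] ++ loop 2 3 (C ++ [.copy 2 4 0] ++ [.copy 1 1 1]), fun n => ⟨?_, ?_⟩⟩
  · intro hH
    by_contra! hne
    refine not_halts_append_loop (hstart n)
      (fun u => u 0 = n ∧ (∃ k : ℕ, u 1 = k) ∧ u 2 ≠ 0 ∧ u 3 = 0)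
      ⟨by simp [input], ⟨0, by simp [input]⟩, by simp [input], by simp [input]⟩ ?_ hH
    rintro u ⟨h0, ⟨k, h1⟩, h2, h3⟩
    obtain ⟨w, hw, w0, w1, w2, w3⟩ := hbody n k u h0 h1 h3
    refine ⟨by rwa [h3], w, ⟨w0, ⟨_, w1⟩, ?_, w3⟩, hw⟩
    rw [w2]
    exact_mod_cast hne k
  · intro hex
    -- Induction on the distance `j` to the least zero of `g n`.
    have key : ∀ j k : ℕ, k + j = Nat.find hex → ∀ u : ℕ → ℤ, u 0 = n → u 1 = k → u 2 ≠ 0 →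
        u 3 = 0 → ∃ w, Runs (loop 2 3 (C ++ [.copy 2 4 0] ++ [.copy 1 1 1])) u w := by
      intro j
      induction j with
      | zero =>
        intro k hk u h0 h1 h2 h3
        obtain ⟨w, hw, w0, w1, w2, w3⟩ := hbody n k u h0 h1 h3
        refine ⟨w, Runs.loop (by rwa [h3]) hw (runs_loop_of_eq _ ?_)⟩
        have hk' : k = Nat.find hex := hk
        rw [w2, w3, hk', Nat.find_spec hex, Nat.cast_zero]
      | succ j ih =>
        intro k hk u h0 h1 h2 h3
        obtain ⟨w, hw, w0, w1, w2, w3⟩ := hbody n k u h0 h1 h3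
        obtain ⟨x, hx⟩ := ih (k + 1) (by omega) w w0 w1
          (by rw [w2]; exact_mod_cast Nat.find_min hex (by omega : k < Nat.find hex)) w3
        exact ⟨x, Runs.loop (by rwa [h3]) hw hx⟩
    obtain ⟨w, hw⟩ := key _ 0 (Nat.zero_add _)
      (Function.update (input n) 2 (input n 2 + 1)) (by simp [input]) (by simp [input])
      (by simp [input]) (by simp [input])
    exact ((hstart n).append hw).halts

end RegisterMachine

namespace QFLIA

/-! ### Definable predicates -/

/-- A function of the assignment that is the value of a linear term. -/
def IsLinear {V : Type} (f : (V → ℤ) → ℤ) : Prop := ∃ t : LinTerm V, ∀ s, t.eval s = f s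

/-- A predicate on assignments that is expressed by a formula. -/
def Definable {V : Type} (p : (V → ℤ) → Prop) : Prop := ∃ φ : Formula V, ∀ s, φ.Sat s ↔ p s

section Definable

variable {V : Type} {f g : (V → ℤ) → ℤ} {p q : (V → ℤ) → Prop}

theorem isLinear_const (c : ℤ) : IsLinear fun _ : V → ℤ => c := ⟨(c, []), by simp [LinTerm.eval]⟩

theorem isLinear_var (v : V) : IsLinear fun s : V → ℤ => s v :=
  ⟨(0, [(1, v)]), by simp [LinTerm.eval]⟩

theorem IsLinear.add (hf : IsLinear f) (hg : IsLinear g) : IsLinear fun s => f s + g s := by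
  obtain ⟨t, ht⟩ := hf
  obtain ⟨u, hu⟩ := hg
  refine ⟨(t.1 + u.1, t.2 ++ u.2), fun s => ?_⟩
  simp only [← ht, ← hu, LinTerm.eval, List.map_append, List.sum_append]
  ring

theorem IsLinear.const_mul (hf : IsLinear f) (c : ℤ) : IsLinear fun s => c * f s := by
  obtain ⟨t, ht⟩ := hf
  refine ⟨(c * t.1, t.2.map fun p => (c * p.1, p.2)), fun s => ?_⟩
  simp [← ht, LinTerm.eval, mul_add, ← List.sum_map_mul_left, Function.comp_def, mul_assoc]

theorem IsLinear.sub (hf : IsLinear f) (hg : IsLinear g) : IsLinear fun s => f s - g s := by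
  simpa [sub_eq_add_neg] using hf.add (hg.const_mul (-1))

theorem Definable.congr (hp : Definable p) (h : ∀ s, p s ↔ q s) : Definable q :=
  hp.imp fun _ hφ s => (hφ s).trans (h s)

theorem IsLinear.le (hf : IsLinear f) (hg : IsLinear g) : Definable fun s => f s ≤ g s := by
  obtain ⟨t, ht⟩ := hf
  obtain ⟨u, hu⟩ := hg
  exact ⟨.le t u, fun s => by rw [Formula.Sat, ht, hu]⟩

theorem IsLinear.eq (hf : IsLinear f) (hg : IsLinear g) : Definable fun s => f s = g s := by
  obtain ⟨t, ht⟩ := hf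
  obtain ⟨u, hu⟩ := hg
  exact ⟨.eq t u, fun s => by rw [Formula.Sat, ht, hu]⟩

theorem Definable.not (hp : Definable p) : Definable fun s => ¬ p s := by
  obtain ⟨φ, hφ⟩ := hp
  exact ⟨.not φ, fun s => by rw [Formula.Sat, hφ]⟩

theorem Definable.and (hp : Definable p) (hq : Definable q) : Definable fun s => p s ∧ q s := by
  obtain ⟨φ, hφ⟩ := hp
  obtain ⟨ψ, hψ⟩ := hq
  exact ⟨.and φ ψ, fun s => by rw [Formula.Sat, hφ, hψ]⟩

theorem Definable.or (hp : Definable p) (hq : Definable q) : Definable fun s => p s ∨ q s := by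
  obtain ⟨φ, hφ⟩ := hp
  obtain ⟨ψ, hψ⟩ := hq
  exact ⟨.or φ ψ, fun s => by rw [Formula.Sat, hφ, hψ]⟩

theorem definable_const (c : Prop) : Definable fun _ : V → ℤ => c := by
  by_cases h : c
  · exact ((isLinear_const 0).eq (isLinear_const 0)).congr fun _ => by simp [h]
  · exact ((isLinear_const 0).eq (isLinear_const 1)).congr fun _ => by simp [h]

theorem definable_exists_mem {ι : Type*} (A : Finset ι) {p : ι → (V → ℤ) → Prop}
    (hp : ∀ i ∈ A, Definable (p i)) : Definable fun s => ∃ i ∈ A, p i s := by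
  classical
  induction A using Finset.induction_on with
  | empty => exact (definable_const False).congr fun s => by simp
  | insert i A _ ih =>
    exact ((hp i (by simp)).or (ih fun j hj => hp j (by simp [hj]))).congr fun s => by simp

theorem definable_exists {ι : Type*} [Finite ι] {p : ι → (V → ℤ) → Prop}
    (hp : ∀ i, Definable (p i)) : Definable fun s => ∃ i, p i s := by
  have := Fintype.ofFinite ι
  exact (definable_exists_mem Finset.univ fun i _ => hp i).congr fun s => by simp

theorem definable_forall {ι : Type*} [Finite ι] {p : ι → (V → ℤ) → Prop}
    (hp : ∀ i, Definable (p i)) : Definable fun s => ∀ i, p i s :=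
  (definable_exists fun i => (hp i).not).not.congr fun s => by simp

theorem definable_mem_finset [Finite V] (A : Finset (V → ℤ)) : Definable fun s => s ∈ A := by
  refine (definable_exists_mem A (p := fun a s => ∀ v, s v = a v) fun a _ =>
    definable_forall fun v => (isLinear_var v).eq (isLinear_const _)).congr fun s => ?_
  simp [← funext_iff]

end Definable

/-! ### The squares are not definable -/

/-- For `b = 0` the two expressions coincide. Otherwise the quadratic term dominates for large `n`,
and both have the sign of `b`. -/
theorem eventually_quadratic_iff (a b c : ℤ) : ∃ N : ℕ, ∀ n : ℕ, N ≤ n →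
    ((a * n + b * n ^ 2 + c ≤ 0 ↔ a * n + b * (n ^ 2 + 1) + c ≤ 0) ∧
      (a * n + b * n ^ 2 + c = 0 ↔ a * n + b * (n ^ 2 + 1) + c = 0)) := by
  refine ⟨a.natAbs + c.natAbs + 1, fun n hn => ?_⟩
  have hn' : |a| + |c| + 1 ≤ (n : ℤ) := by
    rw [Int.abs_eq_natAbs, Int.abs_eq_natAbs]
    exact_mod_cast hn
  generalize (n : ℤ) = m at hn'
  have ha := abs_nonneg a
  have hc := abs_nonneg c
  -- Here `m - |a| ≥ |c| + 1` and `m ≥ 1`, hence `m * (m - |a|) > |c|`.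
  have h1 : |c| < m ^ 2 - |a| * m := by nlinarith
  have h2 : |a * m| = |a| * m := by rw [abs_mul, abs_of_nonneg (by linarith : 0 ≤ m)]
  have h3 := abs_le.1 h2.le
  have h4 := abs_le.1 (le_refl |c|)
  have hm := sq_nonneg m
  rcases lt_trichotomy b 0 with hb | rfl | hb
  · have : b * m ^ 2 ≤ -m ^ 2 := by nlinarith
    have e1 : a * m + b * m ^ 2 + c < 0 := by linarith
    have e2 : a * m + b * (m ^ 2 + 1) + c < 0 := by linarith
    exact ⟨iff_of_true e1.le e2.le, iff_of_false e1.ne e2.ne⟩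
  · simp
  · have : m ^ 2 ≤ b * m ^ 2 := by nlinarith
    have e1 : 0 < a * m + b * m ^ 2 + c := by linarith
    have e2 : 0 < a * m + b * (m ^ 2 + 1) + c := by linarith
    exact ⟨iff_of_false e1.not_ge e2.not_ge, iff_of_false e1.ne' e2.ne'⟩

theorem LinTerm.exists_eval_eq {V : Type} {σ : ℤ → ℤ → V → ℤ}
    (hσ : ∀ v, ∃ a b c : ℤ, ∀ x y, σ x y v = a * x + b * y + c) (t : LinTerm V) :
    ∃ a b c : ℤ, ∀ x y, t.eval (σ x y) = a * x + b * y + c := by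
  obtain ⟨d, l⟩ := t
  induction l with
  | nil => exact ⟨0, 0, d, by simp [LinTerm.eval]⟩
  | cons p l ih =>
    obtain ⟨a, b, c, h⟩ := ih
    obtain ⟨a', b', c', h'⟩ := hσ p.2
    refine ⟨a + p.1 * a', b + p.1 * b', c + p.1 * c', fun x y => ?_⟩
    have := h x y
    simp only [LinTerm.eval, List.map_cons, List.sum_cons, h'] at this ⊢
    linear_combination this

/-- On an affine family of assignments with two parameters, a formula eventually does not
distinguish the parameters `(n, n²)` and `(n, n² + 1)`. -/
theorem Formula.eventually_sat_sq_iff {V : Type} {σ : ℤ → ℤ → V → ℤ}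
    (hσ : ∀ v, ∃ a b c : ℤ, ∀ x y, σ x y v = a * x + b * y + c) (φ : Formula V) :
    ∃ N : ℕ, ∀ n : ℕ, N ≤ n → (φ.Sat (σ n (n ^ 2)) ↔ φ.Sat (σ n (n ^ 2 + 1))) := by
  have atom : ∀ t u : LinTerm V, ∃ N : ℕ, ∀ n : ℕ, N ≤ n →
      ((t.eval (σ n (n ^ 2)) ≤ u.eval (σ n (n ^ 2)) ↔
        t.eval (σ n (n ^ 2 + 1)) ≤ u.eval (σ n (n ^ 2 + 1))) ∧
      (t.eval (σ n (n ^ 2)) = u.eval (σ n (n ^ 2)) ↔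
        t.eval (σ n (n ^ 2 + 1)) = u.eval (σ n (n ^ 2 + 1)))) := by
    intro t u
    obtain ⟨a, b, c, h⟩ := t.exists_eval_eq hσ
    obtain ⟨a', b', c', h'⟩ := u.exists_eval_eq hσ
    -- Both kinds of atom compare the difference of the two sides with zero.
    obtain ⟨N, hN⟩ := eventually_quadratic_iff (a - a') (b - b') (c - c')
    refine ⟨N, fun n hn => ?_⟩
    have e : ∀ y : ℤ, (a - a') * n + (b - b') * y + (c - c') =
        (a * n + b * y + c) - (a' * n + b' * y + c') := fun y => by ring
    simpa only [h, h', e, sub_nonpos, sub_eq_zero] using hN n hn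
  induction φ with
  | le t u => exact (atom t u).imp fun N h n hn => (h n hn).1
  | eq t u => exact (atom t u).imp fun N h n hn => (h n hn).2
  | not φ ih => exact ih.imp fun N h n hn => not_congr (h n hn)
  | and φ ψ ih₁ ih₂ =>
    obtain ⟨N, hN⟩ := ih₁
    obtain ⟨M, hM⟩ := ih₂
    exact ⟨max N M, fun n hn =>
      and_congr (hN n (le_of_max_le_left hn)) (hM n (le_of_max_le_right hn))⟩
  | or φ ψ ih₁ ih₂ =>
    obtain ⟨N, hN⟩ := ih₁
    obtain ⟨M, hM⟩ := ih₂
    exact ⟨max N M, fun n hn =>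
      or_congr (hN n (le_of_max_le_left hn)) (hM n (le_of_max_le_right hn))⟩

end QFLIA

/-! ### Restriction to finitely many registers -/

namespace RegisterMachine

/-- Only registers below `N` occur in the instruction. -/
def Instr.BoundedBy (N : ℕ) : Instr → Prop
  | zero r => r < N
  | copy r q _ => r < N ∧ q < N
  | jeq q r _ => q < N ∧ r < N
  | back _ => True

theorem Instr.BoundedBy.mono {N M : ℕ} (h : N ≤ M) {i : Instr} (hi : i.BoundedBy N) :
    i.BoundedBy M := by
  cases i <;> simp only [BoundedBy] at hi ⊢ <;> omega

theorem exists_boundedBy (P : List Instr) : ∃ N, ∀ i ∈ P, i.BoundedBy N := by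
  induction P with
  | nil => exact ⟨0, by simp⟩
  | cons i P ih =>
    obtain ⟨N, hN⟩ := ih
    obtain ⟨M, hM⟩ : ∃ M, i.BoundedBy M := by
      cases i with
      | zero r => exact ⟨r + 1, Nat.lt_succ_self r⟩
      | copy r q c => exact ⟨r + q + 1, by simp only [Instr.BoundedBy]; omega⟩
      | jeq q r d => exact ⟨r + q + 1, by simp only [Instr.BoundedBy]; omega⟩
      | back d => exact ⟨0, trivial⟩
    refine ⟨max N M, fun j hj => ?_⟩
    rcases List.mem_cons.1 hj with rfl | hj
    · exact hM.mono (le_max_right _ _)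
    · exact (hN j hj).mono (le_max_left _ _)

/-- A state of the system stores only the registers below `N`; nothing else can influence the run.
-/
theorem Instr.BoundedBy.exec_congr {N : ℕ} {i : Instr} (hi : i.BoundedBy N) (p : ℕ)
    {s t : ℕ → ℤ} (h : ∀ r < N, s r = t r) :
    (i.exec (p, s)).1 = (i.exec (p, t)).1 ∧
      ∀ r < N, (i.exec (p, s)).2 r = (i.exec (p, t)).2 r := by
  cases i with
  | zero r =>
    refine ⟨rfl, fun q hq => ?_⟩
    by_cases e : q = r <;> simp [exec, e, h q hq]
  | copy r q c =>
    refine ⟨rfl, fun j hj => ?_⟩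
    by_cases e : j = r <;> simp [exec, e, h j hj, h q hi.2]
  | jeq q r d => simpa [exec, h q hi.1, h r hi.2] using h
  | back d => exact ⟨rfl, h⟩

end RegisterMachine

namespace QFLIA

open RegisterMachine

/-! ### The transition system of a program

The variables are a program counter `0`, two variables `1` and `2`, and the registers. While the
program runs, variable `1` counts the steps and variable `2` is its square. At any time the system
may clear the registers and enter a checking phase with program counter `-1`, in which the count is
run down to zero; there the second variable has to be zero. -/

section Simulation

variable {N : ℕ}

/-- The variable of a register. -/
def regVar (i : Fin N) : Fin (N + 3) := i.succ.succ.succ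

/-- The state with given program counter, count, square and register contents. -/
def mkState (p x y : ℤ) (s : ℕ → ℤ) : Fin (N + 3) → ℤ :=
  Fin.cons p (Fin.cons x (Fin.cons y fun i => s i))

/-- The register contents of a state. -/
def regs (σ : Fin (N + 3) → ℤ) (r : ℕ) : ℤ := if h : r < N then σ (regVar ⟨r, h⟩) else 0

@[simp] theorem mkState_zero (p x y : ℤ) (s : ℕ → ℤ) : (mkState p x y s : Fin (N + 3) → ℤ) 0 = p :=
  rfl

@[simp] theorem mkState_one (p x y : ℤ) (s : ℕ → ℤ) : (mkState p x y s : Fin (N + 3) → ℤ) 1 = x :=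
  rfl

@[simp] theorem mkState_two (p x y : ℤ) (s : ℕ → ℤ) : (mkState p x y s : Fin (N + 3) → ℤ) 2 = y :=
  rfl

@[simp] theorem mkState_regVar (p x y : ℤ) (s : ℕ → ℤ) (i : Fin N) :
    mkState p x y s (regVar i) = s i := rfl

theorem eq_mkState_iff {σ : Fin (N + 3) → ℤ} {p x y : ℤ} {s : ℕ → ℤ} :
    σ = mkState p x y s ↔ σ 0 = p ∧ σ 1 = x ∧ σ 2 = y ∧ ∀ i, σ (regVar i) = s i := by
  refine ⟨by rintro rfl; simp, fun ⟨h0, h1, h2, h3⟩ => funext ?_⟩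
  exact Fin.cases h0 (Fin.cases h1 (Fin.cases h2 h3))

theorem mkState_congr {p x y : ℤ} {s t : ℕ → ℤ} (h : ∀ r < N, s r = t r) :
    (mkState p x y s : Fin (N + 3) → ℤ) = mkState p x y t :=
  eq_mkState_iff.2 ⟨rfl, rfl, rfl, fun i => h i i.2⟩

theorem regs_mkState {p x y : ℤ} {s : ℕ → ℤ} {r : ℕ} (hr : r < N) :
    regs (mkState p x y s : Fin (N + 3) → ℤ) r = s r := by
  simp [regs, hr]

/-- Execution of an instruction of the program. -/
def ProgramStep (P : List Instr) (σ τ : Fin (N + 3) → ℤ) : Prop :=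
  ∃ p : Fin P.length, σ 0 = (p : ℕ) ∧
    τ = mkState ((P[p].exec (p, regs σ)).1 : ℤ) (σ 1 + 1) (σ 2 + 2 * σ 1 + 1)
      (P[p].exec (p, regs σ)).2

/-- Entrance to the checking phase. -/
def EnterCheck (σ τ : Fin (N + 3) → ℤ) : Prop :=
  0 ≤ σ 0 ∧ τ = mkState (-1) (σ 1) (σ 2) 0

/-- A step of the checking phase. -/
def CheckStep (σ τ : Fin (N + 3) → ℤ) : Prop :=
  σ 0 = -1 ∧ 0 < σ 1 ∧ τ = mkState (-1) (σ 1 - 1) (σ 2 - 2 * σ 1 + 1) 0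

/-- The error states: the checking phase ends with a nonzero value. -/
def IsError (σ : Fin (N + 3) → ℤ) : Prop := σ 0 = -1 ∧ σ 1 = 0 ∧ σ 2 ≠ 0

/-- The guard `p < P.length` is essential: `step` idles after halting, and idling here would raise
the count forever and destroy finiteness. -/
theorem programStep_mkState_iff {P : List Instr} (hP : ∀ i ∈ P, i.BoundedBy N) {p : ℕ} {x y : ℤ}
    {s : ℕ → ℤ} {τ : Fin (N + 3) → ℤ} :
    ProgramStep P (mkState p x y s) τ ↔
      p < P.length ∧ τ = mkState ((step P (p, s)).1 : ℤ) (x + 1) (y + 2 * x + 1)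
        (step P (p, s)).2 := by
  have key : ∀ hp : p < P.length,
      (mkState ((P[p].exec (p, regs (mkState p x y s : Fin (N + 3) → ℤ))).1 : ℤ)
        (x + 1) (y + 2 * x + 1) (P[p].exec (p, regs (mkState p x y s : Fin (N + 3) → ℤ))).2 :
          Fin (N + 3) → ℤ) =
      mkState ((step P (p, s)).1 : ℤ) (x + 1) (y + 2 * x + 1) (step P (p, s)).2 := by
    intro hp
    rw [step_of_getElem? (P := P) (c := (p, s)) (List.getElem?_eq_getElem hp)]
    obtain ⟨h1, h2⟩ := (hP _ (List.getElem_mem hp)).exec_congr p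
      (s := regs (mkState p x y s : Fin (N + 3) → ℤ)) (t := s) fun r hr => regs_mkState hr
    rw [h1]
    exact mkState_congr h2
  constructor
  · rintro ⟨⟨q, hq⟩, h0, hτ⟩
    obtain rfl : p = q := by simpa using h0
    exact ⟨hq, hτ.trans (key hq)⟩
  · rintro ⟨hp, hτ⟩
    exact ⟨⟨p, hp⟩, rfl, hτ.trans (key hp).symm⟩

theorem isLinear_regs {W : Type} (e : Fin (N + 3) → W) (r : ℕ) :
    IsLinear fun w : W → ℤ => regs (w ∘ e) r := by
  by_cases h : r < N
  · simpa [regs, h] using isLinear_var (e (regVar ⟨r, h⟩))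
  · simpa [regs, h] using isLinear_const (V := W) 0

theorem isLinear_exec_regs {W : Type} (e : Fin (N + 3) → W) (i : Instr) (p j : ℕ) :
    IsLinear fun w : W → ℤ => (i.exec (p, regs (w ∘ e))).2 j := by
  cases i with
  | zero r =>
    by_cases h : j = r
    · simpa [Instr.exec, h] using isLinear_const 0
    · simpa [Instr.exec, h] using isLinear_regs e j
  | copy r q c =>
    by_cases h : j = r
    · simpa [Instr.exec, h] using (isLinear_regs e q).add (isLinear_const c)
    · simpa [Instr.exec, h] using isLinear_regs e j
  | jeq q r d => exact isLinear_regs e j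
  | back d => exact isLinear_regs e j

/-- A conditional jump makes the new program counter only piecewise constant, hence the disjunction
over the outcome of the test. -/
theorem definable_eq_exec_pc {W : Type} (e : Fin (N + 3) → W) (i : Instr) (p : ℕ) (v : W) :
    Definable fun w : W → ℤ => w v = ((i.exec (p, regs (w ∘ e))).1 : ℤ) := by
  cases i with
  | zero r => exact (isLinear_var v).eq (isLinear_const ((p + 1 : ℕ) : ℤ))
  | copy r q c => exact (isLinear_var v).eq (isLinear_const ((p + 1 : ℕ) : ℤ))
  | back d => exact (isLinear_var v).eq (isLinear_const ((p - d : ℕ) : ℤ))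
  | jeq q r d =>
    have hc := (isLinear_regs e q).eq (isLinear_regs e r)
    refine ((hc.and ((isLinear_var v).eq (isLinear_const ((p + d : ℕ) : ℤ)))).or
      (hc.not.and ((isLinear_var v).eq (isLinear_const ((p + 1 : ℕ) : ℤ))))).congr fun w => ?_
    by_cases h : regs (w ∘ e) q = regs (w ∘ e) r <;> simp [Instr.exec, h]

theorem definable_trans (P : List Instr) :
    Definable fun w : Fin (N + 3) ⊕ Fin (N + 3) → ℤ =>
      ProgramStep P (w ∘ Sum.inl) (w ∘ Sum.inr) ∨ EnterCheck (w ∘ Sum.inl) (w ∘ Sum.inr) ∨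
        CheckStep (w ∘ Sum.inl) (w ∘ Sum.inr) := by
  have hl : ∀ v : Fin (N + 3), IsLinear fun w : Fin (N + 3) ⊕ Fin (N + 3) → ℤ => w (.inl v) :=
    fun v => isLinear_var _
  have hr : ∀ v : Fin (N + 3), IsLinear fun w : Fin (N + 3) ⊕ Fin (N + 3) → ℤ => w (.inr v) :=
    fun v => isLinear_var _
  simp only [ProgramStep, EnterCheck, CheckStep, eq_mkState_iff, Function.comp_apply]
  refine (definable_exists fun p => ((hl 0).eq (isLinear_const _)).and
    ((definable_eq_exec_pc _ _ _ _).and (((hr 1).eq ((hl 1).add (isLinear_const 1))).and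
      (((hr 2).eq (((hl 2).add ((hl 1).const_mul 2)).add (isLinear_const 1))).and
        (definable_forall fun j => (hr _).eq (isLinear_exec_regs _ _ _ _)))))).or
    (Definable.or ?_ ?_)
  · exact ((isLinear_const 0).le (hl 0)).and (((hr 0).eq (isLinear_const _)).and
      (((hr 1).eq (hl 1)).and (((hr 2).eq (hl 2)).and
        (definable_forall fun j => (hr _).eq (isLinear_const 0)))))
  · refine ((hl 0).eq (isLinear_const _)).and (Definable.and ?_
      (((hr 0).eq (isLinear_const _)).and (((hr 1).eq ((hl 1).sub (isLinear_const 1))).and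
        (((hr 2).eq (((hl 2).sub ((hl 1).const_mul 2)).add (isLinear_const 1))).and
          (definable_forall fun j => (hr _).eq (isLinear_const 0))))))
    exact ((hl 1).le (isLinear_const 0)).not.congr fun w => not_le

theorem definable_not_isError : Definable fun σ : Fin (N + 3) → ℤ => ¬ IsError σ :=
  (((isLinear_var 0).eq (isLinear_const _)).and (((isLinear_var 1).eq (isLinear_const _)).and
    ((isLinear_var 2).eq (isLinear_const _)).not)).not

/-! ### Inductive predicates and halting -/

/-- A predicate that is inductive for the system of a program with input `n` and free of errors. -/
structure IsSafeInductive (P : List Instr) (n : ℕ) (I : (Fin (N + 3) → ℤ) → Prop) : Prop where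
  initial : I (mkState 0 0 0 (input n))
  program : ∀ σ τ, I σ → ProgramStep P σ τ → I τ
  enter : ∀ σ τ, I σ → EnterCheck σ τ → I τ
  check : ∀ σ τ, I σ → CheckStep σ τ → I τ
  safe : ∀ σ, I σ → ¬ IsError σ

/-- The state of the system after `m` steps of the program. -/
def runState (P : List Instr) (n m : ℕ) : Fin (N + 3) → ℤ :=
  mkState (((step P)^[m] (0, input n)).1 : ℤ) m (m ^ 2) ((step P)^[m] (0, input n)).2

/-- If the program has halted by time `M`, the run states and the checking states `(m, m ^ 2)` with
`m ≤ M` form a finite set closed under all transitions. -/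
theorem exists_isSafeInductive_of_halts {P : List Instr} (hP : ∀ i ∈ P, i.BoundedBy N) {n : ℕ}
    (h : Halts P (input n)) :
    ∃ I : (Fin (N + 3) → ℤ) → Prop, Definable I ∧ IsSafeInductive P n I := by
  classical
  obtain ⟨M, hM⟩ := h
  -- A program step is possible only before time `M`, so it does not lead out of the set.
  have hlt : ∀ m, ((step P)^[m] (0, input n)).1 < P.length → m < M := fun m hm => by
    by_contra! hle
    exact absurd (length_le_iterate_of_le hle hM) hm.not_ge
  refine ⟨_, definable_mem_finset
    ((Finset.range (M + 1)).image (runState P n) ∪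
      (Finset.range (M + 1)).image fun m : ℕ => mkState (-1) m (m ^ 2) 0), ?_, ?_, ?_, ?_, ?_⟩
  all_goals simp only [Finset.mem_union, Finset.mem_image, Finset.mem_range]
  · exact .inl ⟨0, by omega, by simp [runState]⟩
  · rintro σ τ (⟨m, -, rfl⟩ | ⟨m, -, rfl⟩) hστ
    · obtain ⟨hp, rfl⟩ := (programStep_mkState_iff hP).1 hστ
      refine .inl ⟨m + 1, by have := hlt m hp; omega, ?_⟩
      simp only [runState, Function.iterate_succ_apply']
      congr 1
      push_cast; ring
    · obtain ⟨p, hp, -⟩ := hστ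
      simp only [mkState_zero] at hp
      omega
  · rintro σ τ (⟨m, hm, rfl⟩ | ⟨m, -, rfl⟩) ⟨h0, rfl⟩
    · exact .inr ⟨m, hm, rfl⟩
    · simp at h0
  · rintro σ τ (⟨m, -, rfl⟩ | ⟨m, hm, rfl⟩) ⟨h0, h1, rfl⟩
    · simp only [runState, mkState_zero] at h0
      omega
    · simp only [mkState_one, Nat.cast_pos] at h1
      obtain ⟨k, rfl⟩ := Nat.exists_eq_succ_of_ne_zero h1.ne'
      refine .inr ⟨k, by omega, ?_⟩
      simp only [mkState_one, mkState_two]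
      congr 1 <;> push_cast <;> ring
  · rintro σ (⟨m, -, rfl⟩ | ⟨m, -, rfl⟩) ⟨h0, h1, h2⟩
    · simp only [runState, mkState_zero] at h0
      omega
    · simp only [mkState_one, mkState_two] at h1 h2
      exact h2 (by rw [h1]; rfl)

/-- A checking step preserves `y - x ^ 2`, and safety makes this zero once `x` is zero. -/
theorem IsSafeInductive.eq_sq {P : List Instr} {n : ℕ} {I : (Fin (N + 3) → ℤ) → Prop}
    (h : IsSafeInductive P n I) (m : ℕ) {y : ℤ} (hm : I (mkState (-1) m y 0)) : y = m ^ 2 := by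
  induction m generalizing y with
  | zero =>
    by_contra hy
    exact h.safe _ hm ⟨rfl, rfl, by simpa using hy⟩
  | succ m ih =>
    have := ih (y := y - 2 * (m + 1) + 1) (h.check _ _ hm ⟨rfl, by simp, by simp⟩)
    push_cast
    linear_combination this

theorem IsSafeInductive.halts {P : List Instr} (hP : ∀ i ∈ P, i.BoundedBy N) {n : ℕ}
    {φ : Formula (Fin (N + 3))} (h : IsSafeInductive P n φ.Sat) : Halts P (input n) := by
  by_contra hH
  simp only [Halts, not_exists, not_le] at hH
  have hrun : ∀ m, φ.Sat (runState P n m) := by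
    intro m
    induction m with
    | zero => simpa [runState] using h.initial
    | succ m ih =>
      refine h.program _ _ ih ((programStep_mkState_iff hP).2 ⟨hH m, ?_⟩)
      simp only [runState, Function.iterate_succ_apply']
      congr 1
      push_cast; ring
  -- The checking states form an affine family in the count and the square.
  obtain ⟨M, hM⟩ := φ.eventually_sat_sq_iff (σ := fun x y => mkState (-1) x y 0) <|
    Fin.cases ⟨0, 0, -1, by simp⟩ <| Fin.cases ⟨1, 0, 0, fun x y => by simp⟩ <|
      Fin.cases ⟨0, 1, 0, fun x y => by simp⟩ fun i =>
        ⟨0, 0, 0, fun x y => (mkState_regVar _ _ _ _ i).trans (by simp)⟩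
  have hsq : φ.Sat (mkState (-1) M (M ^ 2) 0) :=
    h.enter _ _ (hrun M) ⟨by simp [runState], rfl⟩
  -- The invariant also contains `(M, M ^ 2 + 1)`, against `eq_sq`.
  have := h.eq_sq M ((hM M le_rfl).1 hsq)
  omega

end Simulation

/-- Halting of a program is expressed by the existence of an invariant for a system in which only
one constant of the initial condition depends on the input. -/
theorem exists_hasInvariant_iff_halts (P : List Instr) :
    ∃ (k : ℕ) (v : Fin k) (ι : Formula (Fin k)) (tr : Formula (Fin k ⊕ Fin k))
      (π : Formula (Fin k)), ∀ n : ℕ,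
        InferenceInstance.HasInvariant
          ⟨⟨k, .and (.eq (0, [(1, v)]) ((n : ℤ), [])) ι, tr⟩, π⟩ ↔ Halts P (input n) := by
  obtain ⟨N₀, hN₀⟩ := exists_boundedBy P
  -- The extra register ensures that the input register 0 exists even if `P` mentions none.
  obtain ⟨N, hN⟩ : ∃ N, N = N₀ + 1 := ⟨_, rfl⟩
  have hP : ∀ i ∈ P, i.BoundedBy N := fun i hi => (hN₀ i hi).mono (by omega)
  have h0 : 0 < N := by omega
  obtain ⟨tr, htr⟩ := definable_trans (N := N) P
  obtain ⟨π, hπ⟩ := definable_not_isError (N := N)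
  -- Everything except register 0 is fixed here, so `ι` does not depend on `n`.
  obtain ⟨ι, hι⟩ : Definable fun σ : Fin (N + 3) → ℤ => σ 0 = 0 ∧ σ 1 = 0 ∧ σ 2 = 0 ∧
      ∀ j : {j : Fin N // j ≠ ⟨0, h0⟩}, σ (regVar j) = 0 :=
    ((isLinear_var 0).eq (isLinear_const 0)).and (((isLinear_var 1).eq (isLinear_const 0)).and
      (((isLinear_var 2).eq (isLinear_const 0)).and
        (definable_forall fun j => (isLinear_var _).eq (isLinear_const 0))))
  refine ⟨N + 3, regVar ⟨0, h0⟩, ι, tr, π, fun n => ?_⟩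
  have hinit : ∀ σ : Fin (N + 3) → ℤ,
      (Formula.and (.eq (0, [(1, regVar ⟨0, h0⟩)]) ((n : ℤ), [])) ι).Sat σ ↔
        σ = mkState 0 0 0 (input n) := by
    intro σ
    rw [Formula.Sat, Formula.Sat, hι, eq_mkState_iff]
    simp only [LinTerm.eval, List.map_cons, List.map_nil, List.sum_cons, List.sum_nil, zero_add,
      add_zero, one_mul]
    constructor
    · rintro ⟨hn, a, b, c, h⟩
      refine ⟨a, b, c, fun i => ?_⟩
      by_cases hi : i = ⟨0, h0⟩
      · rw [hi, hn]; simp [input]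
      · rw [h ⟨i, hi⟩, input, Function.update_of_ne fun e => hi (Fin.ext e)]; rfl
    · rintro ⟨a, b, c, h⟩
      refine ⟨by rw [h]; simp [input], a, b, c, fun ⟨i, hi⟩ => ?_⟩
      rw [h, input, Function.update_of_ne fun e => hi (Fin.ext e)]; rfl
  have hstep : ∀ σ τ : Fin (N + 3) → ℤ, tr.Sat (Sum.elim σ τ) ↔
      ProgramStep P σ τ ∨ EnterCheck σ τ ∨ CheckStep σ τ := fun σ τ => htr (Sum.elim σ τ)
  constructor
  · rintro ⟨φ, hφ⟩
    refine IsSafeInductive.halts hP (φ := φ) ⟨?_, ?_, ?_, ?_, ?_⟩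
    · exact hφ.initiation _ ((hinit _).2 rfl)
    · exact fun σ τ h hs => hφ.consecution σ τ h ((hstep σ τ).2 (.inl hs))
    · exact fun σ τ h hs => hφ.consecution σ τ h ((hstep σ τ).2 (.inr (.inl hs)))
    · exact fun σ τ h hs => hφ.consecution σ τ h ((hstep σ τ).2 (.inr (.inr hs)))
    · exact fun σ h => (hπ σ).1 (hφ.safety σ h)
  · intro hH
    obtain ⟨I, ⟨φ, hφ⟩, hI⟩ := exists_isSafeInductive_of_halts hP hH
    refine ⟨φ, fun σ h => ?_, fun σ τ h hs => ?_, fun σ h => (hπ σ).2 (hI.safe σ ((hφ σ).1 h))⟩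
    · rw [(hinit σ).1 h]
      exact (hφ _).2 hI.initial
    · rcases (hstep σ τ).1 hs with hs | hs | hs
      · exact (hφ τ).2 (hI.program σ τ ((hφ σ).1 h) hs)
      · exact (hφ τ).2 (hI.enter σ τ ((hφ σ).1 h) hs)
      · exact (hφ τ).2 (hI.check σ τ ((hφ σ).1 h) hs)

end QFLIA

/-! ### Computability of the reduction -/

namespace QFLIA

theorem primrec_intCast : Primrec fun n : ℕ => (n : ℤ) :=
  Primrec.encode_iff.1 <| (Primrec.nat_mul.comp (Primrec.const 2) Primrec.id).of_eq fun _ => rfl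

theorem Formula.primrec_eq {α V : Type} [Primcodable α] [Denumerable V] {t u : α → LinTerm V}
    (ht : Primrec t) (hu : Primrec u) : Primrec fun a => Formula.eq (t a) (u a) :=
  Primrec.encode_iff.1 <| Primrec.nat_add.comp (Primrec.nat_mul.comp (Primrec.const 5)
    (Primrec₂.natPair.comp (Primrec.encode.comp ht) (Primrec.encode.comp hu))) (Primrec.const 1)

theorem Formula.primrec_and {α V : Type} [Primcodable α] [Denumerable V] {φ ψ : α → Formula V}
    (hφ : Primrec φ) (hψ : Primrec ψ) : Primrec fun a => Formula.and (φ a) (ψ a) :=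
  Primrec.encode_iff.1 <| Primrec.nat_add.comp (Primrec.nat_mul.comp (Primrec.const 5)
    (Primrec₂.natPair.comp (Primrec.encode.comp hφ) (Primrec.encode.comp hψ))) (Primrec.const 3)

theorem InferenceInstance.primrec_of_toRaw {α : Type} [Primcodable α] {f : α → InferenceInstance}
    (hf : Primrec fun a => (f a).toRaw) : Primrec f :=
  Primrec.encode_iff.1 ((Primrec.encode.comp hf).of_eq fun a => ((f a).encode_eq).symm)

/-- Only the constant `n` varies; all the other ingredients, including the compiled program, are
fixed data. -/
theorem primrec_instance {k : ℕ} (v : Fin k) (ι : Formula (Fin k))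
    (tr : Formula (Fin k ⊕ Fin k)) (π : Formula (Fin k)) :
    Primrec fun n : ℕ =>
      (⟨⟨k, .and (.eq (0, [(1, v)]) ((n : ℤ), [])) ι, tr⟩, π⟩ : InferenceInstance) := by
  have hinit : Primrec fun n : ℕ =>
      Formula.and (.eq (0, [(1, (v : ℕ))]) ((n : ℤ), [])) (ι.map Fin.val) :=
    Formula.primrec_and (Formula.primrec_eq (Primrec.const (0, [(1, (v : ℕ))]))
      (primrec_intCast.pair (Primrec.const []))) (Primrec.const (ι.map Fin.val))
  exact InferenceInstance.primrec_of_toRaw ((Primrec.const k).pair (hinit.pair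
    ((Primrec.const (tr.map (Sum.map Fin.val Fin.val))).pair (Primrec.const (π.map Fin.val)))))

-- The step-bounded evaluator `Code.evaln` is primitive recursive, and `c.eval 0` is defined exactly
-- when some bound `k` gives a value. Searching for `k` is thus a universal program with input the
-- code `c`.
open Nat.Partrec in
theorem exists_halts_iff_eval_dom :
    ∃ P : List RegisterMachine.Instr, ∀ c : Code,
      RegisterMachine.Halts P (RegisterMachine.input (Encodable.encode c)) ↔ (c.eval 0).Dom := by
  obtain ⟨P, hP⟩ := RegisterMachine.exists_halts_iff
    (g := fun n k => bif (Code.evaln k (Denumerable.ofNat Code n) 0).isSome then 0 else 1) <| by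
      have harg : Primrec fun p : ℕ × ℕ => ((p.2, Denumerable.ofNat Code p.1), 0) :=
        (Primrec.snd.pair ((Primrec.ofNat Code).comp Primrec.fst)).pair (Primrec.const 0)
      exact Primrec.cond (Primrec.option_isSome.comp (Code.primrec_evaln.comp harg))
        (Primrec.const 0) (Primrec.const 1)
  refine ⟨P, fun c => (hP _).trans ?_⟩
  simp only [Denumerable.ofNat_encode, Bool.cond_eq_ite, Part.dom_iff_mem, Code.evaln_complete]
  simp only [ite_eq_left_iff, one_ne_zero, imp_false, not_not, Option.isSome_iff_exists]
  exact exists_comm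

end QFLIA

/-- The problem of inferring QFLIA invariants is undecidable. -/
theorem mainTheorem1 :
    ¬ ComputablePred (fun I : QFLIA.InferenceInstance => I.HasInvariant) := by
  intro h
  obtain ⟨P, hP⟩ := QFLIA.exists_halts_iff_eval_dom
  obtain ⟨k, v, ι, tr, π, hI⟩ := QFLIA.exists_hasInvariant_iff_halts P
  refine ComputablePred.halting_problem 0 (ComputablePred.computable_of_manyOneReducible ?_ h)
  exact ⟨_, ((QFLIA.primrec_instance v ι tr π).comp Primrec.encode).to_comp,
    fun c => ((hI _).trans (hP c)).symm⟩
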